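/- A finite list $\sigma=(\sigma_1,\dots,\sigma_k)$ of complex numbers is called realisable if there is an entrywise nonnegative real $k\times k$ matrix whose spectrum (eigenvalues counted with algebraic multiplicity) is $\sigma$. The Perron eigenvalue of a realisable list is its entry equal to $\max_i|\sigma_i|$. Write $s_j(\sigma)=\sum_i\sigma_i^j$. Theorem. Let $(\rho,\lambda_2,\lambda_3,\dots,\lambda_m)$, $m\ge 2$, be a realisable list, where $\rho$ is the Perron eigenvalue, $\lambda_2$ is real and $\rho\ne\lambda_2$. Let $n\ge 3$ be an integer and let $\delta$ be a real number with $$(n-2)\max\{0,\lambda_2\}\ \le\ \delta\ \le\ \tfrac12(n-2)(\rho+\lambda_2).$$ Let $\mu=(\mu_1,\mu_2,\dots,\mu_n)$ be a list of complex numbers, closed under complex conjugation (with multiplicities), such that $\mu_1$ is real and nonnegative, $\mathrm{Re}\,\mu_i\le \delta/(n-2)$ for all $i=2,3,\dots,n$, and $$s_1(\mu)=\rho+\lambda_2+\delta,\qquad s_2(\mu)=\rho^2+\lambda_2^2+\frac{\delta^2}{n-2}.$$ Then the list $(\mu_1,\mu_2,\dots,\mu_n,\lambda_3,\lambda_4,\dots,\lambda_m)$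 is realisable. -/

import Mathlib

/-- A finite list `σ` of complex numbers is realisable if it is the spectrum (the eigenvalues,
counted with algebraic multiplicity) of an entrywise nonnegative real square matrix. -/
def IsRealisable (σ : List ℂ) : Prop :=
  ∃ A : Matrix (Fin σ.length) (Fin σ.length) ℝ,
    (∀ i j, 0 ≤ A i j) ∧ (A.map (algebraMap ℝ ℂ)).charpoly.roots = (σ : Multiset ℂ)

/-- `ρ` is the Perron eigenvalue of (a matrix with) spectrum `σ`: it is an entry of `σ` equal to
the spectral radius, the maximum of the absolute values of the entries. -/
def IsPerronEigenvalue (σ : List ℂ) (ρ : ℝ) : Prop :=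
  (ρ : ℂ) ∈ σ ∧ ∀ z ∈ σ, ‖z‖ ≤ ρ

/-- The list `σ` is closed under complex conjugation: conjugating all the entries gives the same
list up to order, so multiplicities are respected. -/
def ClosedUnderConj (σ : List ℂ) : Prop :=
  (σ.map (starRingEnd ℂ)).Perm σ

/-- The power sum `s_k(σ)`, the sum of the `k`-th powers of the entries of `σ`. -/
noncomputable def powerSum (k : ℕ) (σ : List ℂ) : ℂ :=
  (σ.map (fun z => z ^ k)).sum

/-! Put k = n - 2 and ε = δ/k. Let A be a nonnegative matrix with the given spectrum and a positive
Perron vector. In the plane spanned by the eigenvectors for ρ and λ₂, the extreme rays of the cone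
of nonnegative vectors form a nonnegative X with AX = XΛ, and two coordinate evaluations form a
nonnegative E with EX = 1. Border A by a k × k Jordan block with eigenvalue ε, coupled to A only
through X and E. This multiplies the characteristic polynomial by g(z - ε)/((z - ρ)(z - λ₂)), where
g(y) = y^k (y + ε - ρ)(y + ε - λ₂) - b Σ wᵢ y^(k-1-i), with b > 0 an entry of Λ and free weights wᵢ
≥ 0.

It remains to write ∏(y + ε - μᵢ) in the form g. The conditions on s₁ and s₂ match the top three
coefficients, so the lower ones must be shown nonpositive. The polynomial is (y - ν)h with ν = μ₁ -
ε and the roots of h in the closed left half-plane. The coefficients of h are nonnegative and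
satisfy the 2 × 2 minor inequalities of a Hurwitz matrix. These propagate nonpositivity from the
second and third coefficients, where the bounds on δ provide it, to all later ones
(`coeff_X_sub_C_mul_nonpos`). -/

/-! ### Perron–Frobenius theory -/

/-- For a nonnegative matrix, the Collatz–Wielandt supremum is attained. -/
theorem exists_collatzWielandt {ι : Type*} [Fintype ι] [Nonempty ι] (A : Matrix ι ι ℝ)
    (hA : ∀ i j, 0 ≤ A i j) :
    ∃ t : ℝ, 0 ≤ t ∧ ∃ x ∈ stdSimplex ℝ ι, (∀ i, t * x i ≤ (A.mulVec x) i) ∧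
      ∀ s : ℝ, ∀ y ∈ stdSimplex ℝ ι, (∀ i, s * y i ≤ (A.mulVec y) i) → s ≤ t := by
  classical
  set c : ℝ := ∑ i, ∑ j, A i j with hc
  have hc0 : 0 ≤ c := Finset.sum_nonneg fun i _ => Finset.sum_nonneg fun j _ => hA i j
  -- Summing over i on the simplex bounds s, so the admissible pairs with s ≥ 0 form a compact set.
  have hbound : ∀ s : ℝ, ∀ y ∈ stdSimplex ℝ ι, (∀ i, s * y i ≤ (A.mulVec y) i) → s ≤ c := by
    intro s y hy h
    calc s = ∑ i, s * y i := by rw [← Finset.mul_sum, hy.2, mul_one]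
      _ ≤ ∑ i, (A.mulVec y) i := Finset.sum_le_sum fun i _ => h i
      _ ≤ c := by
        refine Finset.sum_le_sum fun i _ => Finset.sum_le_sum fun j _ => ?_
        exact mul_le_of_le_one_right (hA i j)
          (hy.2 ▸ Finset.single_le_sum (fun k _ => hy.1 k) (Finset.mem_univ j))
  let K : Set (ℝ × (ι → ℝ)) :=
    (Set.Icc 0 c ×ˢ stdSimplex ℝ ι) ∩ {p | ∀ i, p.1 * p.2 i ≤ (A.mulVec p.2) i}
  have hK : IsCompact K := by
    refine (isCompact_Icc.prod (isCompact_stdSimplex ℝ ι)).inter_right ?_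
    simp only [Set.ofPred_forall]
    refine isClosed_iInter fun i => isClosed_le (by fun_prop) ?_
    simp only [Matrix.mulVec, dotProduct]
    fun_prop
  obtain ⟨i₀⟩ := ‹Nonempty ι›
  have hne : K.Nonempty := by
    refine ⟨(0, Pi.single i₀ 1), ⟨⟨⟨le_rfl, hc0⟩, single_mem_stdSimplex ℝ i₀⟩, fun i => ?_⟩⟩
    simpa using hA i i₀
  obtain ⟨p, hp, hmax⟩ := hK.exists_isMaxOn hne continuous_fst.continuousOn
  refine ⟨p.1, hp.1.1.1, p.2, hp.1.2, hp.2, fun s y hy h => ?_⟩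
  rcases le_or_gt s 0 with hs | hs
  · exact hs.trans hp.1.1.1
  · exact hmax (a := (s, y)) ⟨⟨⟨hs.le, hbound s y hy h⟩, hy⟩, h⟩

/-- Existence of a Perron pair for an entrywise positive matrix. -/
theorem exists_perron_of_pos {ι : Type*} [Fintype ι] [Nonempty ι] (A : Matrix ι ι ℝ)
    (hA : ∀ i j, 0 < A i j) :
    ∃ t : ℝ, 0 ≤ t ∧ ∃ x ∈ stdSimplex ℝ ι, A.mulVec x = t • x ∧
      ∀ s : ℝ, ∀ y ∈ stdSimplex ℝ ι, (∀ i, s * y i ≤ (A.mulVec y) i) → s ≤ t := by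
  obtain ⟨t, ht, x, hx, hle, hmax⟩ := exists_collatzWielandt A fun i j => (hA i j).le
  refine ⟨t, ht, x, hx, ?_, hmax⟩
  -- If Ax ≠ tx, then A(Ax - tx) is entrywise positive, so the vector Ax, once normalised, admits a
  -- value larger than t.
  by_contra hne
  have hpos : ∀ y : ι → ℝ, (∀ i, 0 ≤ y i) → (∃ i, y i ≠ 0) → ∀ i, 0 < (A.mulVec y) i := by
    rintro y hy ⟨j, hj⟩ i
    exact Finset.sum_pos' (fun k _ => mul_nonneg (hA i k).le (hy k))
      ⟨j, Finset.mem_univ j, mul_pos (hA i j) ((hy j).lt_of_ne' hj)⟩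
  set w := A.mulVec x with hw
  have hwpos : ∀ i, 0 < w i := by
    refine hpos x hx.1 ?_
    by_contra! h
    have := hx.2
    simp [h] at this
  have hd : ∀ i, 0 < (A.mulVec (w - t • x)) i := by
    refine hpos _ (fun i => by simpa using hle i) ?_
    by_contra! h
    exact hne (sub_eq_zero.1 (funext h))
  obtain ⟨i₀, -, hi₀⟩ := Finset.exists_min_image Finset.univ
    (fun i => (A.mulVec (w - t • x)) i / w i) Finset.univ_nonempty
  set η := (A.mulVec (w - t • x)) i₀ / w i₀ with hη
  have hηpos : 0 < η := div_pos (hd i₀) (hwpos i₀)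
  have hS : 0 < ∑ i, w i := Finset.sum_pos (fun i _ => hwpos i) Finset.univ_nonempty
  have := hmax (t + η) ((∑ i, w i)⁻¹ • w) ⟨fun i => ?_, ?_⟩ fun i => ?_
  · linarith
  · exact mul_nonneg (inv_nonneg.2 hS.le) (hwpos i).le
  · simp [← Finset.mul_sum, hS.ne']
  · have h1 : η * w i ≤ (A.mulVec (w - t • x)) i :=
      (le_div_iff₀ (hwpos i)).1 (hi₀ i (Finset.mem_univ i))
    rw [Matrix.mulVec_sub, Matrix.mulVec_smul, ← hw] at h1
    rw [Matrix.mulVec_smul]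
    simp only [Pi.sub_apply, Pi.smul_apply, smul_eq_mul] at h1 ⊢
    have : (t + η) * w i ≤ (A.mulVec w) i := by linarith
    calc _ = (∑ i, w i)⁻¹ * ((t + η) * w i) := by ring
      _ ≤ _ := mul_le_mul_of_nonneg_left this (inv_nonneg.2 hS.le)

/-- Existence of a Perron pair for an entrywise nonnegative matrix. -/
theorem exists_perron {ι : Type*} [Fintype ι] [Nonempty ι] (A : Matrix ι ι ℝ)
    (hA : ∀ i j, 0 ≤ A i j) :
    ∃ t : ℝ, 0 ≤ t ∧ ∃ x ∈ stdSimplex ℝ ι, A.mulVec x = t • x ∧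
      ∀ s : ℝ, ∀ y ∈ stdSimplex ℝ ι, (∀ i, s * y i ≤ (A.mulVec y) i) → s ≤ t := by
  let e : ℕ → ℝ := fun n => 1 / ((n : ℝ) + 1)
  have he : ∀ n, 0 < e n := fun n => Nat.one_div_pos_of_nat
  let B : ℕ → Matrix ι ι ℝ := fun n => Matrix.of fun i j => A i j + e n
  choose t ht x hx hev hmax using fun n =>
    exists_perron_of_pos (B n) fun i j => add_pos_of_nonneg_of_pos (hA i j) (he n)
  have hBx : ∀ n i, t n * x n i = (A.mulVec (x n)) i + e n := by
    intro n i
    have := congrFun (hev n) i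
    simp only [Pi.smul_apply, smul_eq_mul] at this
    rw [← this]
    simp only [B, Matrix.mulVec, dotProduct, Matrix.of_apply, add_mul, Finset.sum_add_distrib]
    rw [← Finset.mul_sum, (hx n).2, mul_one]
  -- This writes `t n` through `x n`, so a convergent subsequence of the vectors makes the
  -- eigenvalues converge too.
  have hteq : ∀ n, t n = ∑ i, ((A.mulVec (x n)) i + e n) := by
    intro n
    rw [← Finset.sum_congr rfl fun i _ => hBx n i, ← Finset.mul_sum, (hx n).2, mul_one]
  obtain ⟨z, hz, φ, hφ, hlim⟩ := (isCompact_stdSimplex ℝ ι).tendsto_subseq hx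
  have he0 : Filter.Tendsto (e ∘ φ) Filter.atTop (nhds 0) :=
    tendsto_one_div_add_atTop_nhds_zero_nat.comp hφ.tendsto_atTop
  have hAx : ∀ i, Filter.Tendsto (fun n => (A.mulVec (x (φ n))) i + e (φ n)) Filter.atTop
      (nhds ((A.mulVec z) i)) := by
    intro i
    have hcont : Continuous fun v : ι → ℝ => (A.mulVec v) i := by
      simp only [Matrix.mulVec, dotProduct]
      fun_prop
    simpa using ((hcont.tendsto z).comp hlim).add he0
  have htlim : Filter.Tendsto (t ∘ φ) Filter.atTop (nhds (∑ i, (A.mulVec z) i)) := by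
    have : t ∘ φ = fun n => ∑ i, ((A.mulVec (x (φ n))) i + e (φ n)) :=
      funext fun n => hteq (φ n)
    rw [this]
    exact tendsto_finsetSum _ fun i _ => hAx i
  refine ⟨∑ i, (A.mulVec z) i, ge_of_tendsto' htlim fun n => ht _, z, hz, ?_, ?_⟩
  · funext i
    have h1 := htlim.mul ((tendsto_pi_nhds.1 hlim) i)
    refine tendsto_nhds_unique (hAx i) (h1.congr fun n => hBx (φ n) i)
  · intro s y hy h
    refine ge_of_tendsto' htlim fun n => hmax (φ n) s y hy fun i => (h i).trans ?_
    refine Finset.sum_le_sum fun j _ => mul_le_mul_of_nonneg_right ?_ (hy.1 j)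
    simpa [B] using (he (φ n)).le

theorem Matrix.isRoot_charpoly_iff_exists_mulVec_eq {K ι : Type*} [Field K] [Fintype ι]
    [DecidableEq ι] (A : Matrix ι ι K) (z : K) :
    A.charpoly.IsRoot z ↔ ∃ v ≠ 0, A.mulVec v = z • v := by
  rw [Polynomial.IsRoot, Matrix.eval_charpoly, ← Matrix.exists_mulVec_eq_zero_iff]
  refine exists_congr fun v => and_congr_right fun _ => ?_
  rw [Matrix.sub_mulVec, sub_eq_zero, eq_comm, Matrix.scalar_apply, ← Matrix.smul_one_eq_diagonal,
    Matrix.smul_mulVec, Matrix.one_mulVec]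

/-- The Perron eigenvalue of a nonnegative matrix dominates the spectrum and has a nonnegative
eigenvector. -/
theorem exists_perron_eigenvector {ι : Type*} [Fintype ι] [DecidableEq ι] [Nonempty ι]
    (A : Matrix ι ι ℝ) (hA : ∀ i j, 0 ≤ A i j) :
    ∃ t : ℝ, 0 ≤ t ∧ (∃ x : ι → ℝ, (∀ i, 0 ≤ x i) ∧ x ≠ 0 ∧ A.mulVec x = t • x) ∧
      ∀ z : ℂ, (A.map (algebraMap ℝ ℂ)).charpoly.IsRoot z → ‖z‖ ≤ t := by
  obtain ⟨t, ht, x, hx, hev, hmax⟩ := exists_perron A hA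
  refine ⟨t, ht, ⟨x, hx.1, ?_, hev⟩, fun z hz => ?_⟩
  · rintro rfl
    simpa using hx.2
  · obtain ⟨v, hv, hzv⟩ := (Matrix.isRoot_charpoly_iff_exists_mulVec_eq _ z).1 hz
    have hS : 0 < ∑ i, ‖v i‖ := by
      obtain ⟨i, hi⟩ := Function.ne_iff.1 hv
      exact Finset.sum_pos' (fun i _ => norm_nonneg _) ⟨i, Finset.mem_univ i, norm_pos_iff.2 hi⟩
    -- By the triangle inequality, the normalised vector of moduli |vᵢ| admits the value ‖z‖.
    refine hmax ‖z‖ ((∑ i, ‖v i‖)⁻¹ • fun i => ‖v i‖) ⟨fun i => ?_, ?_⟩ fun i => ?_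
    · exact mul_nonneg (inv_nonneg.2 hS.le) (norm_nonneg _)
    · simp [← Finset.mul_sum, hS.ne']
    · rw [Matrix.mulVec_smul]
      have h1 : ‖z‖ * ‖v i‖ ≤ (A.mulVec fun i => ‖v i‖) i := by
        have := congrFun hzv i
        rw [← norm_mul, ← smul_eq_mul, ← Pi.smul_apply, ← this]
        refine (norm_sum_le _ _).trans (Finset.sum_le_sum fun j _ => ?_)
        simp [abs_of_nonneg (hA i j)]
      simp only [Pi.smul_apply, smul_eq_mul]
      calc _ = (∑ i, ‖v i‖)⁻¹ * (‖z‖ * ‖v i‖) := by ring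
        _ ≤ _ := mul_le_mul_of_nonneg_left h1 (inv_nonneg.2 hS.le)

theorem Matrix.isRoot_charpoly_map_iff_exists_eigenvector {ι : Type*} [Fintype ι] [DecidableEq ι]
    (A : Matrix ι ι ℝ) (t : ℝ) :
    (A.map (algebraMap ℝ ℂ)).charpoly.IsRoot t ↔ ∃ v ≠ 0, A.mulVec v = t • v := by
  rw [← Matrix.isRoot_charpoly_iff_exists_mulVec_eq, Matrix.charpoly_map]
  exact Polynomial.isRoot_map_iff (f := algebraMap ℝ ℂ) Complex.ofReal_injective

/-! ### Making the Perron vector positive -/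

/-- Every nonnegative matrix has the same characteristic polynomial as some nonnegative matrix with
a positive Perron eigenvector. -/
theorem exists_charpoly_eq_with_pos_eigenvector (m : ℕ) {ι : Type} [Fintype ι] [DecidableEq ι]
    [Nonempty ι] (hm : Fintype.card ι = m) (A : Matrix ι ι ℝ) (hA : ∀ i j, 0 ≤ A i j) :
    ∃ B : Matrix ι ι ℝ, (∀ i j, 0 ≤ B i j) ∧ B.charpoly = A.charpoly ∧
      ∃ t : ℝ, 0 ≤ t ∧ (∃ x : ι → ℝ, (∀ i, 0 < x i) ∧ B.mulVec x = t • x) ∧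
        ∀ z : ℂ, (A.map (algebraMap ℝ ℂ)).charpoly.IsRoot z → ‖z‖ ≤ t := by
  induction m using Nat.strong_induction_on generalizing ι with
  | _ m ih =>
  obtain ⟨t, ht, ⟨x, hx, hx0, hev⟩, hdom⟩ := exists_perron_eigenvector A hA
  by_cases hS : ∀ i, x i ≠ 0
  · exact ⟨A, hA, rfl, t, ht, ⟨x, fun i => (hx i).lt_of_ne' (hS i), hev⟩, hdom⟩
  push Not at hS
  obtain ⟨i₀, hi₀⟩ := hS
  obtain ⟨i₁, hi₁⟩ := Function.ne_iff.1 hx0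
  let e : ι ≃ {i // x i ≠ 0} ⊕ {i // ¬ x i ≠ 0} := (Equiv.sumCompl _).symm
  have : Nonempty {i // ¬ x i ≠ 0} := ⟨⟨i₀, by simpa using hi₀⟩⟩
  have hA' : ∀ i j, 0 ≤ Matrix.reindex e e A i j := fun i j => hA _ _
  have hcp : (Matrix.reindex e e A).charpoly = A.charpoly := Matrix.charpoly_reindex e A
  -- A vanishing sum of nonnegative terms has zero terms, so A is block triangular with respect to
  -- the support of x.
  have h21 : (Matrix.reindex e e A).toBlocks₂₁ = 0 := by
    ext ⟨i, hi⟩ ⟨j, hj⟩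
    have h0 : x i = 0 := not_not.1 hi
    have h1 : (A.mulVec x) i = 0 := by rw [hev]; simp [h0]
    have h2 := (Finset.sum_eq_zero_iff_of_nonneg
      (fun k _ => mul_nonneg (hA i k) (hx k))).1 h1 j (Finset.mem_univ j)
    exact (mul_eq_zero.1 h2).resolve_right hj
  set A₁ := (Matrix.reindex e e A).toBlocks₁₁ with hA₁
  set A₂ := (Matrix.reindex e e A).toBlocks₂₂ with hA₂
  have hcpA : A.charpoly = A₁.charpoly * A₂.charpoly := by
    rw [← hcp, ← Matrix.fromBlocks_toBlocks (Matrix.reindex e e A), h21,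
      Matrix.charpoly_fromBlocks_zero₂₁]
  obtain ⟨B₂, hB₂, hB₂cp, t₂, ht₂, ⟨z, hz, hzev⟩, -⟩ := ih (Fintype.card {i // ¬ x i ≠ 0})
    (hm ▸ Fintype.card_subtype_lt (x := i₁) (by simpa using hi₁)) rfl A₂ fun i j => hA _ _
  have ht₂t : t₂ ≤ t := by
    have h1 : (A₂.map (algebraMap ℝ ℂ)).charpoly.IsRoot t₂ := by
      rw [Matrix.charpoly_map, ← hB₂cp, ← Matrix.charpoly_map,
        Matrix.isRoot_charpoly_map_iff_exists_eigenvector]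
      refine ⟨z, fun h => ?_, hzev⟩
      have := hz (Classical.arbitrary _)
      rw [h] at this
      exact lt_irrefl _ this
    have h2 := hdom t₂ (by
      rw [Matrix.charpoly_map, hcpA, Polynomial.map_mul, ← Matrix.charpoly_map A₂]
      exact Polynomial.root_mul_left_of_isRoot _ h1)
    simpa [abs_of_nonneg ht₂] using h2
  let x₁ : {i // x i ≠ 0} → ℝ := fun i => x i
  have hx₁ : ∀ i, 0 < x₁ i := fun i => (hx i).lt_of_ne' i.2
  have hsum : 0 < ∑ i, x₁ i := Finset.sum_pos (fun i _ => hx₁ i) ⟨⟨i₁, hi₁⟩, Finset.mem_univ _⟩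
  have hev₁ : A₁.mulVec x₁ = t • x₁ := by
    funext i
    have h1 := congrFun hev i
    have h2 : (A.mulVec x) i = ∑ k, (Matrix.reindex e e A) (e i) k * x (e.symm k) := by
      rw [Matrix.mulVec, dotProduct, ← e.symm.sum_comp]
      simp
    rw [h2, Fintype.sum_sum_type] at h1
    have hei : e i = Sum.inl i := e.eq_symm_apply.1 rfl
    have h3 : ∀ k : {i // ¬ x i ≠ 0}, x (e.symm (Sum.inr k)) = 0 := fun k => not_not.1 k.2
    simp only [h3, mul_zero, Finset.sum_const_zero, add_zero, hei] at h1
    exact h1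
  -- The off-diagonal block does not affect the characteristic polynomial. This rank-one choice
  -- gives K x₁ = (t - t₂) z, hence K x₁ + B₂ z = t z, and it is nonnegative because t₂ ≤ t.
  let K : Matrix {i // ¬ x i ≠ 0} {i // x i ≠ 0} ℝ :=
    Matrix.of fun j _ => (t - t₂) * z j * (∑ i, x₁ i)⁻¹
  refine ⟨Matrix.reindex e.symm e.symm (Matrix.fromBlocks A₁ 0 K B₂), fun i j => ?_, ?_, t, ht,
    ⟨Sum.elim x₁ z ∘ e, fun i => ?_, ?_⟩, hdom⟩
  · simp only [Matrix.reindex_apply, Matrix.submatrix_apply, Equiv.symm_symm]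
    rcases e i with i' | i' <;> rcases e j with j' | j'
    · exact hA _ _
    · exact le_rfl
    · exact mul_nonneg (mul_nonneg (sub_nonneg.2 ht₂t) (hz _).le) (inv_nonneg.2 hsum.le)
    · exact hB₂ _ _
  · rw [Matrix.charpoly_reindex, Matrix.charpoly_fromBlocks_zero₁₂, hB₂cp, hcpA]
  · simp only [Function.comp]
    rcases e i with i' | i'
    · exact hx₁ _
    · exact hz _
  · have hblock : (Matrix.fromBlocks A₁ 0 K B₂).mulVec (Sum.elim x₁ z) = t • Sum.elim x₁ z := by
      rw [Matrix.fromBlocks_mulVec]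
      funext k
      rcases k with k | k
      · simp [hev₁]
      · have : (K.mulVec x₁) k = (t - t₂) * z k := by
          simp only [K, Matrix.mulVec, dotProduct, Matrix.of_apply]
          rw [← Finset.mul_sum, mul_assoc, inv_mul_cancel₀ hsum.ne', mul_one]
        simp [hzev, this]
        ring
    rw [Matrix.reindex_apply, Matrix.submatrix_mulVec_equiv]
    simp only [Equiv.symm_symm]
    rw [Function.comp_assoc, Equiv.self_comp_symm, Function.comp_id, hblock]
    rfl

/-! ### The invariant plane -/

/-- A matrix with a positive Perron vector and a second real eigenvalue preserves a plane which is
spanned by the columns of a nonnegative matrix having a nonnegative left inverse. -/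
theorem exists_nonneg_invariant_plane {ι : Type*} [Fintype ι] [DecidableEq ι] [Nonempty ι]
    (A : Matrix ι ι ℝ) {ρ l : ℝ} (hl : l < ρ) {x y : ι → ℝ} (hx : ∀ i, 0 < x i)
    (hAx : A.mulVec x = ρ • x) (hy : y ≠ 0) (hAy : A.mulVec y = l • y) :
    ∃ (X : Matrix ι (Fin 2) ℝ) (E : Matrix (Fin 2) ι ℝ) (a b c d : ℝ),
      (∀ i j, 0 ≤ X i j) ∧ (∀ i j, 0 ≤ E i j) ∧ E * X = 1 ∧ A * X = X * !![a, b; c, d] ∧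
      0 < b ∧ a + d = ρ + l ∧ a * d - b * c = ρ * l := by
  -- The sign of y is chosen so that the largest ratio M = max yᵢ/xᵢ is positive; this is what makes
  -- b positive.
  wlog hpos : ∃ i, 0 < y i generalizing y
  · refine this (y := -y) (by simpa using hy) (by simp [Matrix.mulVec_neg, hAy]) ?_
    push Not at hpos
    obtain ⟨i, hi⟩ := Function.ne_iff.1 hy
    exact ⟨i, by simpa using (hpos i).lt_of_ne hi⟩
  obtain ⟨i, hi⟩ := hpos
  obtain ⟨p, -, hp⟩ := Finset.exists_max_image Finset.univ (fun i => y i / x i)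
    Finset.univ_nonempty
  obtain ⟨q, -, hq⟩ := Finset.exists_min_image Finset.univ (fun i => y i / x i)
    Finset.univ_nonempty
  set M := y p / x p with hM
  set m := y q / x q with hm
  have hMpos : 0 < M := (div_pos hi (hx i)).trans_le (hp i (Finset.mem_univ i))
  have hyM : ∀ i, y i ≤ M * x i := fun i => (div_le_iff₀ (hx i)).1 (hp i (Finset.mem_univ i))
  have hmy : ∀ i, m * x i ≤ y i := fun i => (le_div_iff₀ (hx i)).1 (hq i (Finset.mem_univ i))
  have hyp : y p = M * x p := by rw [hM, div_mul_cancel₀ _ (hx p).ne']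
  have hyq : y q = m * x q := by rw [hm, div_mul_cancel₀ _ (hx q).ne']
  have hAx' : ∀ i, ∑ j, A i j * x j = ρ * x i := fun i => congrFun hAx i
  have hAy' : ∀ i, ∑ j, A i j * y j = l * y i := fun i => congrFun hAy i
  have hmM : m < M := by
    refine lt_of_le_of_ne (hp q (Finset.mem_univ q)) fun h => ?_
    have hyx : ∀ i, y i = M * x i := fun i => le_antisymm (hyM i) (h ▸ hmy i)
    have h1 := hAy' p
    simp only [hyx, mul_left_comm _ M] at h1
    rw [← Finset.mul_sum, hAx'] at h1
    have : (M * x p) * (ρ - l) = 0 := by linarith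
    exact (mul_pos (mul_pos hMpos (hx p)) (sub_pos.2 hl)).ne' this
  have hΔ : 0 < M - m := sub_pos.2 hmM
  -- The columns are y - m x and M x - y, rescaled. The second vanishes at p and the first at q, so
  -- evaluation at p and q inverts X.
  refine ⟨Matrix.of fun i => ![(y i - m * x i) / (M - m), (M * x i - y i) / (M - m)],
    Matrix.of ![Pi.single p (x p)⁻¹, Pi.single q (x q)⁻¹],
    (l * M - ρ * m) / (M - m), (ρ - l) * M / (M - m), (l - ρ) * m / (M - m),
    (ρ * M - l * m) / (M - m), ?_, ?_, ?_, ?_, ?_, ?_, ?_⟩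
  · intro i j
    fin_cases j
    · exact div_nonneg (sub_nonneg.2 (hmy i)) hΔ.le
    · exact div_nonneg (sub_nonneg.2 (hyM i)) hΔ.le
  · intro i j
    fin_cases i
    · exact Pi.single_nonneg (α := fun _ : ι => ℝ) |>.2 (inv_nonneg.2 (hx p).le) j
    · exact Pi.single_nonneg (α := fun _ : ι => ℝ) |>.2 (inv_nonneg.2 (hx q).le) j
  · have := (hx p).ne'
    have := (hx q).ne'
    have := hΔ.ne'
    ext i j
    fin_cases i <;> fin_cases j <;>
      simp [Matrix.mul_apply, Pi.single_apply, hyp, hyq] <;> field_simp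
  · have := hΔ.ne'
    ext i j
    fin_cases j
    · have : ∑ k, A i k * ((y k - m * x k) / (M - m)) = (l * y i - m * (ρ * x i)) / (M - m) := by
        rw [← hAx', ← hAy', Finset.mul_sum, ← Finset.sum_sub_distrib, Finset.sum_div]
        exact Finset.sum_congr rfl fun k _ => by ring
      simp only [Matrix.mul_apply, Fin.sum_univ_two, Matrix.of_apply, Fin.zero_eta,
        Matrix.cons_val_zero, Matrix.cons_val_one, this]
      field_simp
      ring
    · have : ∑ k, A i k * ((M * x k - y k) / (M - m)) = (M * (ρ * x i) - l * y i) / (M - m) := by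
        rw [← hAx', ← hAy', Finset.mul_sum, ← Finset.sum_sub_distrib, Finset.sum_div]
        exact Finset.sum_congr rfl fun k _ => by ring
      simp only [Matrix.mul_apply, Fin.sum_univ_two, Matrix.of_apply, Fin.mk_one,
        Matrix.cons_val_zero, Matrix.cons_val_one, this]
      field_simp
      ring
  · exact div_pos (mul_pos (sub_pos.2 hl) hMpos) hΔ
  · field_simp; ring
  · field_simp; ring

/-! ### Determinant of the bordered matrix -/

/-- Since P⁻¹X = XR⁻¹, the perturbed matrix is P(1 - XR⁻¹WE). Sylvester's identity det(1 - UV) =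
det(1 - VU) and EX = 1 then reduce the change to the small matrix R. -/
theorem Matrix.det_sub_mul_mul_of_comm {K m n : Type*} [Field K] [Fintype m] [DecidableEq m]
    [Fintype n] [DecidableEq n] {P : Matrix m m K} {R W : Matrix n n K} {X : Matrix m n K}
    {E : Matrix n m K} (hP : P.det ≠ 0) (hR : R.det ≠ 0) (hPX : P * X = X * R) (hEX : E * X = 1) :
    (P - X * W * E).det * R.det = P.det * (R - W).det := by
  have hP' : IsUnit P.det := isUnit_iff_ne_zero.2 hP
  have hR' : IsUnit R.det := isUnit_iff_ne_zero.2 hR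
  have h1 : P * (1 - X * (R⁻¹ * W * E)) = P - X * W * E := by
    rw [Matrix.mul_sub, Matrix.mul_one, ← Matrix.mul_assoc P, hPX, Matrix.mul_assoc X R,
      Matrix.mul_assoc R⁻¹, Matrix.mul_nonsing_inv_cancel_left _ _ hR', Matrix.mul_assoc X]
  have h2 : R * (1 - R⁻¹ * W * E * X) = R - W := by
    rw [Matrix.mul_assoc _ E, hEX, Matrix.mul_one, Matrix.mul_sub, Matrix.mul_one,
      Matrix.mul_nonsing_inv_cancel_left _ _ hR']
  rw [← h1, ← h2, Matrix.det_mul, Matrix.det_mul, Matrix.det_one_sub_mul_comm]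
  ring

/-- An upper bidiagonal matrix: a Jordan block. -/
def jordanBlock (k : ℕ) (ε : ℝ) : Matrix (Fin k) (Fin k) ℝ :=
  Matrix.of fun i j => if i = j then ε else if (i : ℕ) + 1 = j then 1 else 0

theorem det_scalar_sub_jordanBlock (k : ℕ) (ε z : ℝ) :
    (Matrix.scalar (Fin k) z - jordanBlock k ε).det = (z - ε) ^ k := by
  rw [Matrix.det_of_isUpperTriangular]
  · simp [jordanBlock]
  · intro i j hij
    have h1 : i ≠ j := (ne_of_lt hij).symm
    have h2 : ¬ (i : ℕ) + 1 = j := by have : (j : ℕ) < i := hij; lia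
    simp [jordanBlock, h1, h2]

/-- This identifies the first row of the inverse of z - J as successive powers of (z - ε)⁻¹. -/
theorem sum_mul_scalar_sub_jordanBlock (k : ℕ) {ε z : ℝ} (hz : z ≠ ε) (j : Fin k) :
    ∑ i : Fin k, ((z - ε)⁻¹) ^ ((i : ℕ) + 1) * (Matrix.scalar (Fin k) z - jordanBlock k ε) i j =
      if (j : ℕ) = 0 then 1 else 0 := by
  have hx : z - ε ≠ 0 := sub_ne_zero.2 hz
  set x := z - ε with hxd
  have hent : ∀ i : Fin k, (Matrix.scalar (Fin k) z - jordanBlock k ε) i j =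
      (if i = j then x else 0) - if (i : ℕ) + 1 = j then 1 else 0 := by
    intro i
    by_cases h : i = j
    · subst h; simp [jordanBlock, hxd]
    · simp [jordanBlock, h]
  simp only [hent, mul_sub, Finset.sum_sub_distrib]
  rw [Finset.sum_eq_single j (by intro i _ h; simp [h]) (by simp)]
  rcases Nat.eq_zero_or_pos (j : ℕ) with h | h
  · simp [h, hx]
  · rw [Finset.sum_eq_single ⟨j - 1, by lia⟩]
    · simp only [if_true, h.ne', if_false]
      rw [if_pos (by lia), pow_succ, mul_assoc, inv_mul_cancel₀ hx, show (j : ℕ) - 1 + 1 = j by lia]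
      ring
    · intro i _ hi
      rw [if_neg, mul_zero]
      intro h'
      exact hi (Fin.ext (by simp; lia))
    · simp

/-- The characteristic polynomial of the bordered matrix used to replace two eigenvalues. -/
theorem det_scalar_sub_bordered {ι : Type*} [Fintype ι] [DecidableEq ι] {k : ℕ} 
    (A : Matrix ι ι ℝ) {X : Matrix ι (Fin 2) ℝ} {E : Matrix (Fin 2) ι ℝ} {a b c d : ℝ}
    (hEX : E * X = 1) (hAX : A * X = X * !![a, b; c, d]) (w : Fin k → ℝ) (ε z : ℝ) (hz : z ≠ ε)
    (hzA : (Matrix.scalar ι z - A).det ≠ 0) (hzΛ : (z - a) * (z - d) - b * c ≠ 0) :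
    (Matrix.scalar (ι ⊕ Fin k) z - Matrix.fromBlocks A
        (X * (Matrix.of ![fun _ => 0, fun j => if (j : ℕ) = 0 then 1 else 0] :
          Matrix (Fin 2) (Fin k) ℝ))
        (Matrix.of (fun i => ![w i, 0]) * E) (jordanBlock k ε)).det *
      ((z - a) * (z - d) - b * c) =
    (Matrix.scalar ι z - A).det * (z - ε) ^ k *
      ((z - a) * (z - d) - b * c - b * ∑ i : Fin k, ((z - ε)⁻¹) ^ ((i : ℕ) + 1) * w i) := by
  set U : Matrix (Fin 2) (Fin k) ℝ :=
    Matrix.of ![fun _ => 0, fun j : Fin k => if (j : ℕ) = 0 then 1 else 0] with hU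
  set V : Matrix (Fin k) (Fin 2) ℝ := Matrix.of (fun i => ![w i, 0]) with hV
  set D := Matrix.scalar (Fin k) z - jordanBlock k ε with hD
  have hDdet : D.det = (z - ε) ^ k := det_scalar_sub_jordanBlock k ε z
  have hDunit : IsUnit D.det := by
    rw [hDdet]; exact isUnit_iff_ne_zero.2 (pow_ne_zero _ (sub_ne_zero.2 hz))
  let _ := D.invertibleOfIsUnitDet hDunit
  have hblock : Matrix.scalar (ι ⊕ Fin k) z - Matrix.fromBlocks A (X * U) (V * E) (jordanBlock k ε) =
      Matrix.fromBlocks (Matrix.scalar ι z - A) (-(X * U)) (-(V * E)) D := by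
    ext (i | i) (j | j) <;> simp [hD, Matrix.diagonal_apply]
  have hUD : U * ⅟D =
      Matrix.of ![fun _ => 0, fun i : Fin k => ((z - ε)⁻¹) ^ ((i : ℕ) + 1)] := by
    refine (Matrix.mul_left_inj_of_invertible D).1 ?_
    rw [Matrix.invOf_mul_cancel_right]
    ext i j
    fin_cases i
    · simp [Matrix.mul_apply, hU]
    · exact (sum_mul_scalar_sub_jordanBlock k hz j).symm
  set s := ∑ i : Fin k, ((z - ε)⁻¹) ^ ((i : ℕ) + 1) * w i with hs
  -- The Schur complement perturbs Λ in its lower left entry only, so the 2 × 2 determinant changes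
  -- by -b s.
  have hW : U * ⅟D * V = !![0, 0; s, 0] := by
    rw [hUD]
    ext i j
    fin_cases i <;> fin_cases j <;> simp [Matrix.mul_apply, hV, hs]
  have hR : (Matrix.scalar (Fin 2) z - !![a, b; c, d]).det = (z - a) * (z - d) - b * c := by
    simp [Matrix.det_fin_two]
  have hRW : (Matrix.scalar (Fin 2) z - !![a, b; c, d] - !![0, 0; s, 0]).det =
      (z - a) * (z - d) - b * c - b * s := by
    simp [Matrix.det_fin_two]; ring
  have key := Matrix.det_sub_mul_mul_of_comm (P := Matrix.scalar ι z - A)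
    (R := Matrix.scalar (Fin 2) z - !![a, b; c, d]) (W := !![0, 0; s, 0]) (X := X) (E := E) hzA
    (by rwa [hR]) (by
      rw [Matrix.sub_mul, Matrix.mul_sub, hAX, Matrix.scalar_apply, Matrix.scalar_apply,
        ← Matrix.smul_one_eq_diagonal, ← Matrix.smul_one_eq_diagonal]
      simp) hEX
  rw [hR, hRW] at key
  have hschur : -(X * U) * ⅟D * -(V * E) = X * !![0, 0; s, 0] * E := by
    rw [← hW]; simp only [Matrix.neg_mul, Matrix.mul_neg, neg_neg, Matrix.mul_assoc]
  rw [hblock, Matrix.det_fromBlocks₂₂, hschur, hDdet, mul_assoc, key]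
  ring

open Polynomial

/-! ### Coefficients of Hurwitz polynomials -/

/-- The `2 × 2` minor condition `h_d h_{d+u+v} ≤ h_{d+u} h_{d+v}` for `v` even, shared by the
coefficient sequences of (weakly) Hurwitz stable polynomials. -/
def HurwitzMinors (h : ℤ → ℝ) : Prop :=
  ∀ (d u v : ℤ), 0 ≤ u → 0 ≤ v → Even v → h d * h (d + u + v) ≤ h (d + u) * h (d + v)

/-- The two inner factors commute, so it does not matter which of the two gaps is the even one. -/
theorem HurwitzMinors.even_or_even {h : ℤ → ℝ} (H : HurwitzMinors h) {a b c d : ℤ}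
    (hsum : d + a = b + c) (hdb : d ≤ b) (hdc : d ≤ c) (hev : Even (b - d) ∨ Even (c - d)) :
    h d * h a ≤ h b * h c := by
  rcases hev with hev | hev
  · have := H d (c - d) (b - d) (by lia) (by lia) hev
    rw [show d + (c - d) + (b - d) = a by lia, show d + (c - d) = c by lia,
      show d + (b - d) = b by lia] at this
    linarith
  · have := H d (b - d) (c - d) (by lia) (by lia) hev
    rw [show d + (b - d) + (c - d) = a by lia, show d + (c - d) = c by lia,
      show d + (b - d) = b by lia] at this
    linarith

/-- Multiplication by a quadratic with nonnegative coefficients preserves the minor condition. -/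
theorem HurwitzMinors.mul_quadratic {h : ℤ → ℝ} (H : HurwitzMinors h) {a s b : ℝ}
    (ha : 0 ≤ a) (hs : 0 ≤ s) (hb : 0 ≤ b) :
    HurwitzMinors fun i => b * h i + s * h (i - 1) + a * h (i - 2) := by
  intro d u v hu hv hev
  rcases hu.eq_or_lt with rfl | hu
  · simp
  rcases hv.eq_or_lt with rfl | hv
  · simp only [add_zero]; exact (mul_comm _ _).le
  have hv2 : 2 ≤ v := by obtain ⟨r, rfl⟩ := hev; lia
  obtain ⟨r, hr⟩ := hev
  -- Both products are expanded and compared by coefficient: `shift` treats b², s², a²; `lin` treats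
  -- bs and sa; `quad` treats ba.
  have shift : ∀ e : ℤ, h (d - e) * h (d + u + v - e) ≤ h (d + u - e) * h (d + v - e) := fun e =>
    H.even_or_even (by lia) (by lia) (by lia) (Or.inr ⟨r, by lia⟩)
  have lin : ∀ e : ℤ, h (d - e) * h (d + u + v - 1 - e) + h (d - 1 - e) * h (d + u + v - e) ≤
      h (d + u - e) * h (d + v - 1 - e) + h (d + u - 1 - e) * h (d + v - e) := by
    intro e
    -- The parity of u decides how left and right terms are paired: straight with even gap u, or
    -- crosswise with even gap v.
    rcases Int.even_or_odd u with ⟨q, hq⟩ | ⟨q, hq⟩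
    · exact add_le_add
        (H.even_or_even (by lia) (by lia) (by lia) (Or.inl ⟨q, by lia⟩))
        (H.even_or_even (by lia) (by lia) (by lia) (Or.inl ⟨q, by lia⟩))
    · rw [add_comm (h (d + u - e) * _)]
      exact add_le_add
        (H.even_or_even (by lia) (by lia) (by lia) (Or.inr ⟨r, by lia⟩))
        (H.even_or_even (by lia) (by lia) (by lia) (Or.inr ⟨r, by lia⟩))
  have quad : h d * h (d + u + v - 2) + h (d - 2) * h (d + u + v) ≤
      h (d + u) * h (d + v - 2) + h (d + u - 2) * h (d + v) := by
    by_cases hu1 : u = 1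
    · subst hu1
      have e1 : h (d - 2) * h (d + 1 + v) ≤ h (d + 1 - 2) * h (d + v) :=
        H.even_or_even (by lia) (by lia) (by lia) (Or.inr ⟨r + 1, by lia⟩)
      have e2 : h d * h (d + 1 + v - 2) ≤ h (d + 1) * h (d + v - 2) :=
        H.even_or_even (by lia) (by lia) (by lia) (Or.inr ⟨r - 1, by lia⟩)
      linarith
    · exact add_le_add
        (H.even_or_even (by lia) (by lia) (by lia) (Or.inr ⟨r - 1, by lia⟩))
        (H.even_or_even (by lia) (by lia) (by lia) (Or.inr ⟨r + 1, by lia⟩))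
  have s0 := shift 0
  have s1 := shift 1
  have s2 := shift 2
  have l0 := lin 0
  have l1 := lin 1
  simp only [sub_zero, sub_sub] at s0 s1 s2 l0 l1 quad ⊢
  norm_num only at s0 s1 s2 l0 l1 quad ⊢
  have t0 := mul_le_mul_of_nonneg_left s0 (mul_nonneg hb hb)
  have t1 := mul_le_mul_of_nonneg_left s1 (mul_nonneg hs hs)
  have t2 := mul_le_mul_of_nonneg_left s2 (mul_nonneg ha ha)
  have t3 := mul_le_mul_of_nonneg_left l0 (mul_nonneg hb hs)
  have t4 := mul_le_mul_of_nonneg_left l1 (mul_nonneg hs ha)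
  have t5 := mul_le_mul_of_nonneg_left quad (mul_nonneg hb ha)
  linarith

/-- The coefficients of a polynomial, extended by zero to negative indices. -/
noncomputable def intCoeff (p : ℝ[X]) (i : ℤ) : ℝ := if 0 ≤ i then p.coeff i.toNat else 0

theorem intCoeff_natCast (p : ℝ[X]) (i : ℕ) : intCoeff p i = p.coeff i := by simp [intCoeff]

theorem intCoeff_X_mul (p : ℝ[X]) (i : ℤ) : intCoeff (X * p) i = intCoeff p (i - 1) := by
  obtain ⟨n, rfl | rfl⟩ := i.eq_nat_or_neg
  · cases n with
    | zero => simp [intCoeff]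
    | succ n =>
      rw [intCoeff_natCast, coeff_X_mul, Nat.cast_succ, add_sub_cancel_right, intCoeff_natCast]
  · rcases n.eq_zero_or_pos with rfl | hn
    · simp [intCoeff]
    · rw [intCoeff, if_neg (by lia), intCoeff, if_neg (by lia)]

theorem intCoeff_add (p q : ℝ[X]) (i : ℤ) :
    intCoeff (p + q) i = intCoeff p i + intCoeff q i := by
  unfold intCoeff; split_ifs <;> simp

theorem intCoeff_C_mul (a : ℝ) (p : ℝ[X]) (i : ℤ) :
    intCoeff (C a * p) i = a * intCoeff p i := by
  unfold intCoeff; split_ifs <;> simp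

theorem intCoeff_quadratic_mul (a s b : ℝ) (p : ℝ[X]) :
    intCoeff ((C a * X ^ 2 + C s * X + C b) * p) =
      fun i => b * intCoeff p i + s * intCoeff p (i - 1) + a * intCoeff p (i - 2) := by
  funext i
  have : (C a * X ^ 2 + C s * X + C b) * p = C b * p + C s * (X * p) + C a * (X * (X * p)) := by
    ring
  rw [this]
  simp only [intCoeff_add, intCoeff_C_mul, intCoeff_X_mul, sub_sub]
  norm_num only

theorem intCoeff_nonneg_of_quadratic_mul {a s b : ℝ} {p : ℝ[X]} (ha : 0 ≤ a) (hs : 0 ≤ s)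
    (hb : 0 ≤ b) (hp : (∀ i, 0 ≤ intCoeff p i) ∧ HurwitzMinors (intCoeff p)) :
    (∀ i, 0 ≤ intCoeff ((C a * X ^ 2 + C s * X + C b) * p) i) ∧
      HurwitzMinors (intCoeff ((C a * X ^ 2 + C s * X + C b) * p)) := by
  rw [intCoeff_quadratic_mul]
  refine ⟨fun i => ?_, hp.2.mul_quadratic ha hs hb⟩
  have := hp.1 i
  have := hp.1 (i - 1)
  have := hp.1 (i - 2)
  positivity

/-- A monic real polynomial whose complex roots have nonpositive real part has nonnegative
coefficients, satisfying the minor condition. -/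
theorem hurwitzMinors_of_re_nonpos (h : ℝ[X]) (hm : h.Monic)
    (hr : ∀ z : ℂ, aeval z h = 0 → z.re ≤ 0) :
    (∀ i, 0 ≤ intCoeff h i) ∧ HurwitzMinors (intCoeff h) := by
  induction hd : h.natDegree using Nat.strong_induction_on generalizing h with
  | _ n ih =>
  by_cases h1 : h = 1
  · subst h1
    have hc : ∀ i : ℤ, intCoeff 1 i = if i = 0 then 1 else 0 := by
      intro i
      simp only [intCoeff, coeff_one]
      split_ifs <;> first | rfl | lia
    refine ⟨fun i => ?_, fun d u v hu hv _ => ?_⟩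
    · rw [hc]; split_ifs <;> norm_num
    · simp only [hc]
      split_ifs <;> first | lia | norm_num
  -- One form serves both kinds of factor: a = 0 for a real root, a = 1 for a conjugate pair.
  have step : ∀ a s b : ℝ, 0 ≤ a → 0 ≤ s → 0 ≤ b →
      (C a * X ^ 2 + C s * X + C b).Monic → 0 < (C a * X ^ 2 + C s * X + C b).natDegree →
      (C a * X ^ 2 + C s * X + C b) ∣ h →
      (∀ i, 0 ≤ intCoeff h i) ∧ HurwitzMinors (intCoeff h) := by
    rintro a s b ha hs hb hq hdeg ⟨p, rfl⟩
    have hpm : p.Monic := hq.of_mul_monic_left hm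
    refine intCoeff_nonneg_of_quadratic_mul ha hs hb (ih p.natDegree ?_ p hpm ?_ rfl)
    · rw [← hd, hq.natDegree_mul hpm]; lia
    · intro z hz
      exact hr z (by rw [map_mul, hz, mul_zero])
  obtain ⟨z, hz⟩ : ∃ z : ℂ, aeval z h = 0 := by
    refine IsAlgClosed.exists_aeval_eq_zero ℂ h fun hdeg => h1 ?_
    exact eq_one_of_monic_natDegree_zero hm (natDegree_eq_of_degree_eq_some hdeg)
  have hzr := hr z hz
  by_cases him : z.im = 0
  · have hz' : z = (algebraMap ℝ ℂ) z.re := by apply Complex.ext <;> simp [him]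
    have hroot : h.IsRoot z.re := by
      rw [hz', aeval_algebraMap_apply] at hz
      simpa [IsRoot] using hz
    have e : C (0 : ℝ) * X ^ 2 + C 1 * X + C (-z.re) = X - C z.re := by
      simp only [map_zero, map_one, map_neg]; ring
    refine step 0 1 (-z.re) le_rfl zero_le_one (by linarith) ?_ ?_ ?_
    · rw [e]; exact monic_X_sub_C _
    · rw [e, natDegree_X_sub_C]; exact one_pos
    · rw [e]; exact dvd_iff_isRoot.2 hroot
  · have e : C (1 : ℝ) * X ^ 2 + C (-(2 * z.re)) * X + C (‖z‖ ^ 2) =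
        X ^ 2 - C (2 * z.re) * X + C (‖z‖ ^ 2) := by
      simp only [map_one, map_neg]; ring
    have hdeg : (C (1 : ℝ) * X ^ 2 + C (-(2 * z.re)) * X + C (‖z‖ ^ 2)).natDegree = 2 :=
      natDegree_quadratic one_ne_zero
    refine step 1 (-(2 * z.re)) (‖z‖ ^ 2) zero_le_one (by linarith) (by positivity) ?_ ?_ ?_
    · rw [Monic, leadingCoeff_quadratic one_ne_zero]
    · rw [hdeg]; exact two_pos
    · rw [e]; exact quadratic_dvd_of_aeval_eq_zero_im_ne_zero h hz him

/-- If all complex roots of the monic polynomial `h` have nonpositive real part, `0 ≤ ν` and the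
second and third leading coefficients of `(X - ν) h` are nonpositive, then so are all the
following ones. -/
theorem coeff_X_sub_C_mul_nonpos (h : ℝ[X]) (hm : h.Monic)
    (hr : ∀ z : ℂ, aeval z h = 0 → z.re ≤ 0) (ν : ℝ) (N : ℕ) (hN : h.natDegree = N + 1)
    (hc₁ : h.coeff N ≤ ν) (hc₂ : ((X - C ν) * h).coeff N ≤ 0) (i : ℕ) (hi : i < N) :
    ((X - C ν) * h).coeff i ≤ 0 := by
  obtain ⟨hnn, H⟩ := hurwitzMinors_of_re_nonpos h hm hr
  have htop : intCoeff h (N + 1) = 1 := by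
    have := intCoeff_natCast h (N + 1)
    push_cast at this
    rw [this, ← hN]
    exact hm
  have hcoeff : ∀ j : ℕ, ((X - C ν) * h).coeff j = intCoeff h (j - 1) - ν * intCoeff h j := by
    intro j
    rw [← intCoeff_natCast, sub_eq_add_neg, ← C_neg, add_mul, intCoeff_add, intCoeff_X_mul,
      intCoeff_C_mul]
    ring
  rw [hcoeff] at hc₂ ⊢
  rw [← intCoeff_natCast] at hc₁
  have hν : 0 ≤ ν := (hnn _).trans hc₁
  rw [sub_nonpos] at hc₂ ⊢
  -- For N - i odd, the inequality is h_{i-1} h_{N+1} ≤ h_i h_N with h_{N+1} = 1. For N - i even it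
  -- is h_{i-1} h_N ≤ h_i h_{N-1}, which needs h_N > 0; if h_N = 0, then h_{N-1} = 0 and a gap of 2
  -- gives h_{i-1} ≤ 0.
  rcases (Nat.even_or_odd (N - i)).symm with ⟨r, hr'⟩ | ⟨r, hr'⟩
  · have e := H.even_or_even (d := (i : ℤ) - 1) (a := N + 1) (b := i) (c := N) (by lia) (by lia)
      (by lia) (Or.inr ⟨r + 1, by lia⟩)
    rw [htop, mul_one] at e
    refine e.trans ?_
    rw [mul_comm]
    exact mul_le_mul_of_nonneg_right hc₁ (hnn _)
  · rcases (hnn N).eq_or_lt with h0 | h0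
    · rw [← h0, mul_zero] at hc₂
      have e := H.even_or_even (d := (i : ℤ) - 1) (a := N + 1) (b := i + 1) (c := N - 1) (by lia)
        (by lia) (by lia) (Or.inl ⟨1, by lia⟩)
      rw [htop, mul_one] at e
      have : intCoeff h (N - 1) = 0 := le_antisymm hc₂ (hnn _)
      rw [this, mul_zero] at e
      exact e.trans (mul_nonneg hν (hnn _))
    · have e := H.even_or_even (d := (i : ℤ) - 1) (a := N) (b := i) (c := N - 1) (by lia) (by lia)
        (by lia) (Or.inr ⟨r, by lia⟩)
      refine le_of_mul_le_mul_right (e.trans ?_) h0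
      calc _ ≤ intCoeff h i * (ν * intCoeff h N) := mul_le_mul_of_nonneg_left hc₂ (hnn _)
        _ = _ := by ring

/-! ### Polynomials with prescribed roots and power sums -/

/-- The monic polynomial whose list of roots is `l`. -/
noncomputable def polyOfRoots (l : List ℂ) : ℂ[X] := (l.map fun z => X - C z).prod

theorem polyOfRoots_cons (z : ℂ) (l : List ℂ) :
    polyOfRoots (z :: l) = (X - C z) * polyOfRoots l := by simp [polyOfRoots]

theorem polyOfRoots_append (l l' : List ℂ) :
    polyOfRoots (l ++ l') = polyOfRoots l * polyOfRoots l' := by simp [polyOfRoots]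

theorem polyOfRoots_eq_multiset_prod (l : List ℂ) :
    polyOfRoots l = ((l : Multiset ℂ).map fun z => X - C z).prod := by simp [polyOfRoots]

theorem polyOfRoots_perm {l l' : List ℂ} (h : l.Perm l') : polyOfRoots l = polyOfRoots l' :=
  (h.map _).prod_eq

theorem monic_polyOfRoots (l : List ℂ) : (polyOfRoots l).Monic := by
  rw [polyOfRoots_eq_multiset_prod]
  exact monic_multiset_prod_of_monic _ _ fun z _ => monic_X_sub_C z

theorem roots_polyOfRoots (l : List ℂ) : (polyOfRoots l).roots = l := by
  rw [polyOfRoots_eq_multiset_prod, roots_multiset_prod_X_sub_C]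

theorem natDegree_polyOfRoots (l : List ℂ) : (polyOfRoots l).natDegree = l.length := by
  rw [polyOfRoots_eq_multiset_prod, natDegree_multiset_prod_X_sub_C_eq_card, Multiset.coe_card]

theorem isRoot_polyOfRoots {l : List ℂ} {z : ℂ} : (polyOfRoots l).IsRoot z ↔ z ∈ l := by
  rw [← mem_roots (monic_polyOfRoots l).ne_zero, roots_polyOfRoots, Multiset.mem_coe]

theorem polyOfRoots_map_sub_comp (l : List ℂ) (ε : ℂ) :
    (polyOfRoots (l.map fun z => z - ε)).comp (X - C ε) = polyOfRoots l := by
  induction l with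
  | nil => simp [polyOfRoots]
  | cons z l ih =>
    rw [List.map_cons, polyOfRoots_cons, polyOfRoots_cons, mul_comp, ih]
    simp

theorem coeff_X_sub_C_mul_succ {R : Type*} [CommRing R] (p : R[X]) (z : R) (i : ℕ) :
    ((X - C z) * p).coeff (i + 1) = p.coeff i - z * p.coeff (i + 1) := by
  rw [sub_mul, coeff_sub, coeff_X_mul, coeff_C_mul]

theorem coeff_polyOfRoots_length (l : List ℂ) : (polyOfRoots l).coeff l.length = 1 := by
  rw [← natDegree_polyOfRoots]; exact monic_polyOfRoots l

theorem coeff_polyOfRoots_second (l : List ℂ) (i : ℕ) (h : i + 1 = l.length) :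
    (polyOfRoots l).coeff i = -powerSum 1 l := by
  induction l generalizing i with
  | nil => simp at h
  | cons z l ih =>
    have hi : i = l.length := by simpa using h
    have hz : powerSum 1 (z :: l) = z + powerSum 1 l := by simp [powerSum]
    rw [polyOfRoots_cons, hz]
    cases i with
    | zero =>
      obtain rfl := List.length_eq_zero_iff.1 hi.symm
      simp [polyOfRoots, powerSum]
    | succ i =>
      rw [coeff_X_sub_C_mul_succ, ih i hi, hi, coeff_polyOfRoots_length]
      ring

theorem coeff_polyOfRoots_third (l : List ℂ) (i : ℕ) (h : i + 2 = l.length) :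
    2 * (polyOfRoots l).coeff i = powerSum 1 l ^ 2 - powerSum 2 l := by
  induction l generalizing i with
  | nil => simp at h
  | cons z l ih =>
    have hi : i + 1 = l.length := by simpa using h
    have hz : powerSum 1 (z :: l) = z + powerSum 1 l := by simp [powerSum]
    have hz2 : powerSum 2 (z :: l) = z ^ 2 + powerSum 2 l := by simp [powerSum]
    have h2 := coeff_polyOfRoots_second l i hi
    rw [polyOfRoots_cons, hz, hz2]
    cases i with
    | zero =>
      obtain ⟨y, rfl⟩ := List.length_eq_one_iff.1 hi.symm
      simp [polyOfRoots, powerSum]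
      ring
    | succ i =>
      rw [coeff_X_sub_C_mul_succ, mul_sub, ih i hi, h2]
      ring

theorem powerSum_map_sub (l : List ℂ) (ε : ℂ) :
    powerSum 1 (l.map fun z => z - ε) = powerSum 1 l - l.length * ε ∧
    powerSum 2 (l.map fun z => z - ε) =
      powerSum 2 l - 2 * ε * powerSum 1 l + l.length * ε ^ 2 := by
  induction l with
  | nil => simp [powerSum]
  | cons z l ih =>
    obtain ⟨h1, h2⟩ := ih
    simp only [powerSum, List.map_cons, List.sum_cons, List.length_cons] at h1 h2 ⊢
    rw [h1, h2]
    constructor <;> push_cast <;> ring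

/-- The monic polynomial of a list closed under conjugation has real coefficients. -/
theorem ClosedUnderConj.exists_real_poly {l : List ℂ} (h : ClosedUnderConj l) :
    ∃ p : ℝ[X], p.Monic ∧ p.map (algebraMap ℝ ℂ) = polyOfRoots l := by
  have hconj : (polyOfRoots l).map (starRingEnd ℂ) = polyOfRoots l := by
    conv_rhs => rw [← polyOfRoots_perm h]
    simp [polyOfRoots, Polynomial.map_list_prod, Function.comp_def]
  have hl : polyOfRoots l ∈ lifts (algebraMap ℝ ℂ) := by
    rw [lifts_iff_coeff_lifts]
    intro i
    have : starRingEnd ℂ ((polyOfRoots l).coeff i) = (polyOfRoots l).coeff i := by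
      rw [← coeff_map, hconj]
    obtain ⟨r, hr⟩ := Complex.conj_eq_iff_real.1 this
    exact ⟨r, hr.symm⟩
  obtain ⟨p, hp, -, hm⟩ := lifts_and_natDegree_eq_and_monic hl (monic_polyOfRoots l)
  exact ⟨p, hm, hp⟩

/-! ### Replacing the two eigenvalues -/

theorem isRealisable_of_charpoly_eq {κ : Type*} [Fintype κ] [DecidableEq κ] (M : Matrix κ κ ℝ)
    (hM : ∀ i j, 0 ≤ M i j) {l : List ℂ}
    (h : (M.map (algebraMap ℝ ℂ)).charpoly = polyOfRoots l) : IsRealisable l := by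
  have hcard : Fintype.card κ = l.length := by
    rw [← natDegree_polyOfRoots, ← h, Matrix.charpoly_natDegree_eq_dim]
  let e : κ ≃ Fin l.length := Fintype.equivFinOfCardEq hcard
  refine ⟨Matrix.reindex e e M, fun i j => hM _ _, ?_⟩
  rw [Matrix.charpoly_map, Matrix.charpoly_reindex, ← Matrix.charpoly_map, h, roots_polyOfRoots]

theorem charpoly_eq_polyOfRoots {κ : Type*} [Fintype κ] [DecidableEq κ] (A : Matrix κ κ ℂ)
    {l : List ℂ} (h : A.charpoly.roots = l) : A.charpoly = polyOfRoots l := by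
  rw [polyOfRoots_eq_multiset_prod, ← h]
  exact (IsAlgClosed.splits _).eq_prod_roots_of_monic A.charpoly_monic

/-- A matrix with a suitable invariant plane of eigenvalues `ρ, l` can be bordered so that these two
eigenvalues are replaced by the roots of `g(X - ε)`, if the lower coefficients of `g` are
nonpositive. -/
theorem exists_bordered_charpoly {ι : Type*} [Fintype ι] [DecidableEq ι] {k : ℕ}
    (A : Matrix ι ι ℝ) (hA : ∀ i j, 0 ≤ A i j) {X₀ : Matrix ι (Fin 2) ℝ} {E : Matrix (Fin 2) ι ℝ}
    {a b c d ρ l ε : ℝ} (hX : ∀ i j, 0 ≤ X₀ i j) (hE : ∀ i j, 0 ≤ E i j)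
    (hEX : E * X₀ = 1) (hAX : A * X₀ = X₀ * !![a, b; c, d]) (hb : 0 < b) (htr : a + d = ρ + l)
    (hdet : a * d - b * c = ρ * l) (hε : 0 ≤ ε) (g : ℝ[X]) (hg : g.natDegree = k + 2)
    (hg2 : g.coeff (k + 2) = 1) (hg1 : g.coeff (k + 1) = -((ρ - ε) + (l - ε)))
    (hg0 : g.coeff k = (ρ - ε) * (l - ε)) (hneg : ∀ i < k, g.coeff i ≤ 0) :
    ∃ M : Matrix (ι ⊕ Fin k) (ι ⊕ Fin k) ℝ, (∀ i j, 0 ≤ M i j) ∧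
      M.charpoly * ((X - C ρ) * (X - C l)) = A.charpoly * g.comp (X - C ε) := by
  -- Solves -b wᵢ = coefficient of y^(k-1-i) in g.
  let w : Fin k → ℝ := fun i => -g.coeff (k - 1 - i) / b
  have hw : ∀ i, 0 ≤ w i := fun i => div_nonneg (neg_nonneg.2 (hneg _ (by lia))) hb.le
  refine ⟨Matrix.fromBlocks A
        (X₀ * (Matrix.of ![fun _ => 0, fun j => if (j : ℕ) = 0 then 1 else 0] :
          Matrix (Fin 2) (Fin k) ℝ))
        (Matrix.of (fun i => ![w i, 0]) * E) (jordanBlock k ε), ?_, ?_⟩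
  · rintro (i | i) (j | j)
    · exact hA i j
    · simp only [Matrix.fromBlocks_apply₁₂, Matrix.mul_apply, Fin.sum_univ_two]
      have := hX i 1
      simp only [Matrix.of_apply, Matrix.cons_val_zero, Matrix.cons_val_one]
      split_ifs <;> simp [this]
    · simp only [Matrix.fromBlocks_apply₂₁, Matrix.mul_apply, Fin.sum_univ_two]
      simpa using mul_nonneg (hw i) (hE 0 j)
    · simp only [Matrix.fromBlocks_apply₂₂, jordanBlock, Matrix.of_apply]
      split_ifs <;> simp [hε]
  -- This nonzero factor vanishes exactly where the determinant formula is unavailable, so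
  -- multiplying by it leaves only the good z to check.
  have hr0 : (X - C ε) * A.charpoly * ((X - C ρ) * (X - C l)) ≠ 0 :=
    mul_ne_zero (mul_ne_zero (X_sub_C_ne_zero _) A.charpoly_monic.ne_zero)
      (mul_ne_zero (X_sub_C_ne_zero _) (X_sub_C_ne_zero _))
  refine mul_left_cancel₀ hr0 (Polynomial.funext fun z => ?_)
  rw [eval_mul (p := (X - C ε) * A.charpoly * ((X - C ρ) * (X - C l))),
    eval_mul (p := (X - C ε) * A.charpoly * ((X - C ρ) * (X - C l)))]
  by_cases hz : ((X - C ε) * A.charpoly * ((X - C ρ) * (X - C l))).eval z = 0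
  · rw [hz, zero_mul, zero_mul]
  congr 1
  simp only [eval_mul, eval_sub, eval_X, eval_C, mul_eq_zero, not_or] at hz
  obtain ⟨⟨hzε, hzA⟩, hzρ, hzl⟩ := hz
  rw [Matrix.eval_charpoly] at hzA
  have hΛ : (z - a) * (z - d) - b * c = (z - ρ) * (z - l) := by
    linear_combination -z * htr + hdet
  have key := det_scalar_sub_bordered A hEX hAX w ε z (sub_ne_zero.1 hzε) hzA
    (by rw [hΛ]; exact mul_ne_zero hzρ hzl)
  rw [hΛ] at key
  simp only [eval_mul, eval_comp, Matrix.eval_charpoly, eval_sub, eval_X, eval_C]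
  rw [key, mul_assoc]
  congr 1
  set y := z - ε with hy
  have hsum : y ^ k * (b * ∑ i : Fin k, (y⁻¹) ^ ((i : ℕ) + 1) * w i) =
      -∑ i ∈ Finset.range k, g.coeff i * y ^ i := by
    rw [← Finset.sum_range_reflect, ← Fin.sum_univ_eq_sum_range
      (fun j => g.coeff (k - 1 - j) * y ^ (k - 1 - j)), Finset.mul_sum, Finset.mul_sum,
      ← Finset.sum_neg_distrib]
    refine Finset.sum_congr rfl fun i _ => ?_
    have hk : y ^ k = y ^ (k - 1 - i) * y ^ ((i : ℕ) + 1) := by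
      rw [← pow_add]; congr 1; lia
    rw [hk, inv_pow]
    simp only [w]
    have := hb.ne'
    have := pow_ne_zero ((i : ℕ) + 1) hzε
    field_simp
  rw [mul_sub, hsum, eval_eq_sum_range, hg, Finset.sum_range_succ, Finset.sum_range_succ,
    Finset.sum_range_succ, hg0, hg1, hg2, show z = y + ε by rw [hy]; ring]
  ring

theorem mainTheorem1
    -- the list `(ρ, lam₂, λ₃, …, λₘ)`, where `τ = (λ₃, …, λₘ)`
    (ρ lam₂ : ℝ) (τ : List ℂ)
    (hσ : IsRealisable ((ρ : ℂ) :: (lam₂ : ℂ) :: τ))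
    (hρ : IsPerronEigenvalue ((ρ : ℂ) :: (lam₂ : ℂ) :: τ) ρ)
    (hne : ρ ≠ lam₂)
    (n : ℕ) (hn : 3 ≤ n)
    (δ : ℝ)
    (hδ_lower : ((n : ℝ) - 2) * max 0 lam₂ ≤ δ)
    (hδ_upper : δ ≤ 1 / 2 * ((n : ℝ) - 2) * (ρ + lam₂))
    -- the list `(μ₁, μ₂, …, μₙ)`, where `μ' = (μ₂, …, μₙ)`
    (μ₁ : ℝ) (μ' : List ℂ)
    (hlen : ((μ₁ : ℂ) :: μ').length = n)
    (hconj : ClosedUnderConj ((μ₁ : ℂ) :: μ'))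
    (hμ₁ : 0 ≤ μ₁)
    (hre : ∀ z ∈ μ', z.re ≤ δ / ((n : ℝ) - 2))
    (hs₁ : powerSum 1 ((μ₁ : ℂ) :: μ') = ((ρ + lam₂ + δ : ℝ) : ℂ))
    (hs₂ : powerSum 2 ((μ₁ : ℂ) :: μ') =
      ((ρ ^ 2 + lam₂ ^ 2 + δ ^ 2 / ((n : ℝ) - 2) : ℝ) : ℂ)) :
    IsRealisable (((μ₁ : ℂ) :: μ') ++ τ) := by
  obtain ⟨k, rfl⟩ : ∃ k, n = k + 2 := ⟨n - 2, by lia⟩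
  have hk : (0 : ℝ) < k := by exact_mod_cast (show 0 < k by lia)
  rw [show ((k + 2 : ℕ) : ℝ) - 2 = k by push_cast; ring] at *
  -- Translation by -ε moves μ₂, …, μₙ into the closed left half-plane.
  obtain ⟨ε, rfl⟩ : ∃ ε, δ = k * ε := ⟨δ / k, by field_simp⟩
  rw [mul_div_cancel_left₀ _ hk.ne'] at hre
  have hε : max 0 lam₂ ≤ ε := le_of_mul_le_mul_left hδ_lower hk
  have hε0 : 0 ≤ ε := (le_max_left _ _).trans hε
  have hlε : lam₂ ≤ ε := (le_max_right _ _).trans hε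
  have hpq : 0 ≤ (ρ - ε) + (lam₂ - ε) := by
    have : ε ≤ 1 / 2 * (ρ + lam₂) := le_of_mul_le_mul_left (by linarith) hk
    linarith
  have hlρ : lam₂ < ρ := by
    have := hρ.2 lam₂ (by simp)
    rw [Complex.norm_real] at this
    exact lt_of_le_of_ne ((Real.le_norm_self _).trans this) hne.symm
  have hlen' : μ'.length = k + 1 := by simpa using hlen
  -- the real polynomial with roots `μᵢ - ε`
  have hconj' : ClosedUnderConj (μ'.map fun z => z - (ε : ℂ)) := by
    have h1 : (μ'.map (starRingEnd ℂ)).Perm μ' := by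
      simpa [ClosedUnderConj] using hconj
    have h2 := h1.map fun z => z - (ε : ℂ)
    simpa [ClosedUnderConj, Function.comp_def] using h2
  obtain ⟨h, hm, hh⟩ := hconj'.exists_real_poly
  set g := (X - C (μ₁ - ε)) * h with hgdef
  have hg : g.map (algebraMap ℝ ℂ) =
      polyOfRoots (((μ₁ : ℂ) :: μ').map fun z => z - (ε : ℂ)) := by
    rw [List.map_cons, polyOfRoots_cons, ← hh, hgdef]
    simp
  have hroots : ∀ z : ℂ, aeval z h = 0 → z.re ≤ 0 := by
    intro z hz
    rw [← eval_map_algebraMap, hh] at hz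
    obtain ⟨y, hy, rfl⟩ := List.mem_map.1 (isRoot_polyOfRoots.1 hz)
    simpa using hre y hy
  have hhdeg : h.natDegree = k + 1 := by
    rw [← natDegree_map (algebraMap ℝ ℂ), hh, natDegree_polyOfRoots, List.length_map, hlen']
  have hgm : g.Monic := (monic_X_sub_C _).mul hm
  have hgdeg : g.natDegree = k + 2 := by
    rw [hgdef, (monic_X_sub_C _).natDegree_mul hm, natDegree_X_sub_C, hhdeg]; ring
  have hcoeff : ∀ i, ((g.coeff i : ℝ) : ℂ) =
      (polyOfRoots (((μ₁ : ℂ) :: μ').map fun z => z - (ε : ℂ))).coeff i := by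
    intro i; rw [← hg, coeff_map]; rfl
  -- After the shift, the first two power sums are those of ρ - ε, λ₂ - ε and k zeros, which fixes
  -- the top three coefficients of g.
  obtain ⟨ps₁, ps₂⟩ := powerSum_map_sub ((μ₁ : ℂ) :: μ') ε
  have hg2 : g.coeff (k + 2) = 1 := by rw [← hgdeg]; exact hgm
  have hg1 : g.coeff (k + 1) = -((ρ - ε) + (lam₂ - ε)) := by
    have := hcoeff (k + 1)
    rw [coeff_polyOfRoots_second _ _ (by rw [List.length_map, hlen]), ps₁, hs₁, hlen] at this
    apply Complex.ofReal_injective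
    rw [this]; push_cast; ring
  have hg0 : g.coeff k = (ρ - ε) * (lam₂ - ε) := by
    have h2 := coeff_polyOfRoots_third (((μ₁ : ℂ) :: μ').map fun z => z - (ε : ℂ)) k
      (by rw [List.length_map, hlen])
    rw [← hcoeff, ps₁, ps₂, hs₁, hs₂, hlen] at h2
    have h3 : 2 * g.coeff k = 2 * ((ρ - ε) * (lam₂ - ε)) := by
      apply Complex.ofReal_injective
      have hk' : (k : ℂ) ≠ 0 := by exact_mod_cast hk.ne'
      push_cast at h2 ⊢
      rw [h2]
      field_simp
      ring
    linarith
  -- The upper bound on δ makes (ρ - ε) + (λ₂ - ε) nonnegative. With λ₂ ≤ ε from the lower bound,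
  -- this forces ε ≤ ρ, hence (ρ - ε)(λ₂ - ε) ≤ 0.
  have hneg : ∀ i < k, g.coeff i ≤ 0 := by
    refine coeff_X_sub_C_mul_nonpos h hm hroots (μ₁ - ε) k hhdeg ?_ ?_
    · have h1 := coeff_X_sub_C_mul_succ h (μ₁ - ε) k
      have h2 : h.coeff (k + 1) = 1 := by rw [← hhdeg]; exact hm
      rw [← hgdef, hg1, h2] at h1
      linarith
    · rw [← hgdef, hg0]
      exact mul_nonpos_of_nonneg_of_nonpos (by linarith) (by linarith)
  -- the matrix realising the original list
  obtain ⟨A₀, hA₀, hroots₀⟩ := hσ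
  have hcp₀ := charpoly_eq_polyOfRoots _ hroots₀
  obtain ⟨A, hA, hcpA, t, ht, ⟨x, hx, hAx⟩, hdom⟩ :=
    exists_charpoly_eq_with_pos_eigenvector _ (Fintype.card_fin _) A₀ hA₀
  have hcp : (A.map (algebraMap ℝ ℂ)).charpoly = polyOfRoots ((ρ : ℂ) :: (lam₂ : ℂ) :: τ) := by
    rw [Matrix.charpoly_map, hcpA, ← Matrix.charpoly_map, hcp₀]
  have hxne : x ≠ 0 := by
    rintro rfl
    exact lt_irrefl _ (hx ⟨0, by simp⟩)
  -- Both numbers are eigenvalues and both dominate the spectrum.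
  have htρ : t = ρ := by
    have h1 := (Matrix.isRoot_charpoly_map_iff_exists_eigenvector A t).2 ⟨x, hxne, hAx⟩
    rw [hcp, isRoot_polyOfRoots] at h1
    have h2 := hρ.2 _ h1
    have h3 := hdom ρ (by rw [hcp₀, isRoot_polyOfRoots]; simp)
    rw [Complex.norm_real] at h2 h3
    exact le_antisymm ((Real.le_norm_self _).trans h2) ((Real.le_norm_self _).trans h3)
  subst htρ
  obtain ⟨y, hy, hAy⟩ := (Matrix.isRoot_charpoly_map_iff_exists_eigenvector A lam₂).1
    (by rw [hcp, isRoot_polyOfRoots]; simp)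
  obtain ⟨X₀, E, a, b, c, d, hX, hE, hEX, hAX, hb, htr, hdet⟩ :=
    exists_nonneg_invariant_plane A hlρ hx hAx hy hAy
  obtain ⟨M, hM, hMcp⟩ := exists_bordered_charpoly A hA hX hE hEX hAX hb htr hdet hε0 g hgdeg hg2
    hg1 hg0 hneg
  refine isRealisable_of_charpoly_eq M hM ?_
  have h1 := congrArg (Polynomial.map (algebraMap ℝ ℂ)) hMcp
  rw [Polynomial.map_mul, Polynomial.map_mul (p := A.charpoly), ← Matrix.charpoly_map,
    ← Matrix.charpoly_map, hcp, Polynomial.map_comp, hg] at h1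
  have h2 : (X - C ε : ℝ[X]).map (algebraMap ℝ ℂ) = X - C (ε : ℂ) := by simp
  rw [h2, polyOfRoots_map_sub_comp, polyOfRoots_cons, polyOfRoots_cons (lam₂ : ℂ)] at h1
  have h3 : ((X - C t) * (X - C lam₂) : ℝ[X]).map (algebraMap ℝ ℂ) =
      (X - C (t : ℂ)) * (X - C (lam₂ : ℂ)) := by simp
  rw [h3] at h1
  refine mul_right_cancel₀ (mul_ne_zero (X_sub_C_ne_zero (t : ℂ)) (X_sub_C_ne_zero (lam₂ : ℂ))) ?_
  rw [h1, polyOfRoots_append]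
  ring
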